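/- Let $\mathbb{K}$ be a field of characteristic $0$ and let $\mathbb{K}\langle X,Y\rangle$ be the unital associative algebra of formal power series in two non-commuting indeterminates $X,Y$. Write $[a,b]=ab-ba$, $\mathrm{ad}_a b=[a,b]$, and let $\mathcal{L}(X,Y)$ be the Lie algebra of Lie polynomials, i.e. the smallest $\mathbb{K}$-subspace of $\mathbb{K}\langle X,Y\rangle$ containing $X,Y$ and closed under $[\cdot,\cdot]$. Infinite products are understood coefficientwise (each coefficient of the partial products is eventually constant). **Symmetric Zassenhaus formula.** There is exactly one sequence $C_2,C_3,C_4,\dots$ such that each $C_k\in\mathcal{L}(X,Y)$ is homogeneous of degree $k$ (possibly zero) and $$ e^{X+Y}=e^{X/2}\,e^{Y/2}\,\bigl(e^{C_2}e^{C_3}\cdots e^{C_k}\cdots\bigr)\bigl(\cdots e^{C_k}\cdots e^{C_3}e^{C_2}\bigr)\,e^{Y/2}\,e^{X/2}. $$ Moreover $C_{2k}=0$ for all $k\ge 1$, so that $$ e^{X+Y}=e^{X/2}\,e^{Y/2}\,\bigl(e^{C_3}e^{C_5}\cdots e^{C_{2k+1}}\cdots\bigr)\bigl(\cdots e^{C_{2k+1}}\cdots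 e^{C_5}e^{C_3}\bigr)\,e^{Y/2}\,e^{X/2}. $$ The exponents are given by the following recursion. Put $f_{1,0}=g_{1,0}=\tfrac12(X+Y)$ and, for $\ell\ge 1$, $$ f_{1,\ell}=\frac{(-1)^\ell}{2^\ell}\Bigl(\frac{1}{2\,\ell!}\,\mathrm{ad}_Y^{\ell}X+\sum_{j=0}^{\ell}\frac{1}{j!(\ell-j)!}\,\mathrm{ad}_Y^{\ell-j}\mathrm{ad}_X^{j}Y\Bigr),\qquad g_{1,\ell}=\frac{1}{\ell!\,2^{\ell+1}}\,\mathrm{ad}_Y^{\ell}X. $$ Then $C_k=\frac{1}{2k}\bigl(f_{k-1,k-1}-g_{k-1,k-1}\bigr)$ for all $k\ge 2$, where for $n\ge2$ and $\ell\ge0$ $$ f_{n,\ell}=\sum_{j=0}^{\lfloor \ell/n\rfloor}\frac{(-1)^j}{j!}\,\mathrm{ad}_{C_n}^j\tilde f_{n-1,\ell-nj},\qquad g_{n,\ell}=\sum_{j=0}^{\lfloor \ell/n\rfloor}\frac{1}{j!}\,\mathrm{ad}_{C_n}^j\tilde g_{n-1,\ell-nj}, $$ with $\tilde f_{n-1,\ell}=f_{n-1,\ell}$,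 $\tilde g_{n-1,\ell}=g_{n-1,\ell}$ for $\ell\ne n-1$, and $\tilde f_{n-1,n-1}=f_{n-1,n-1}-nC_n$, $\tilde g_{n-1,n-1}=g_{n-1,n-1}+nC_n$. The exponents of odd degree are also produced by the recursion that uses odd indices only: with $\varphi_{1,\ell}=f_{1,\ell}$, $\gamma_{1,\ell}=g_{1,\ell}$, one has $C_3=\frac16(\varphi_{1,2}-\gamma_{1,2})$ and, for $k=3,5,7,\dots$, $C_{k+2}=\frac{1}{2(k+2)}\bigl(\varphi_{k,k+1}-\gamma_{k,k+1}\bigr)$, where $$ \varphi_{k,\ell}=\sum_{j=0}^{\lfloor \ell/k\rfloor}\frac{(-1)^j}{j!}\,\mathrm{ad}_{C_k}^j\varphi_{k-2,\ell-kj},\qquad \gamma_{k,\ell}=\sum_{j=0}^{\lfloor \ell/k\rfloor}\frac{1}{j!}\,\mathrm{ad}_{C_k}^j\gamma_{k-2,\ell-kj}\qquad(\ell\ne k-1), $$ and $\varphi_{k,k-1}=\varphi_{k-2,k-1}-kC_k$, $\gamma_{k,k-1}=\gamma_{k-2,k-1}+kC_k$. -/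

import Mathlib

/-- Formal power series with coefficients in `K` in the non-commuting indeterminates indexed
by `σ`: a series is the family of its coefficients, indexed by words in the alphabet `σ`. -/
def NCSeries (σ : Type*) (K : Type*) : Type _ := List σ → K

namespace NCSeries

section Coefficients

variable {σ : Type*} {K : Type*}

/-- The coefficient of the word `w` in a series. -/
def coeff (w : List σ) (f : NCSeries σ K) : K := f w

@[ext] theorem ext {f g : NCSeries σ K} (h : ∀ w, coeff w f = coeff w g) : f = g := funext h

/-- The series that has the prescribed coefficients. -/
def mk (c : List σ → K) : NCSeries σ K := c

@[simp] theorem coeff_mk (c : List σ → K) (w : List σ) : coeff w (mk c) = c w := rfl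

end Coefficients

section Ring

variable {σ : Type*} {K : Type*} [CommRing K]

instance : AddCommGroup (NCSeries σ K) := inferInstanceAs (AddCommGroup (List σ → K))

instance : Module K (NCSeries σ K) := inferInstanceAs (Module K (List σ → K))

@[simp] theorem coeff_zero (w : List σ) : coeff w (0 : NCSeries σ K) = 0 := rfl

@[simp] theorem coeff_add (w : List σ) (f g : NCSeries σ K) :
    coeff w (f + g) = coeff w f + coeff w g := rfl

@[simp] theorem coeff_smul (w : List σ) (r : K) (f : NCSeries σ K) :
    coeff w (r • f) = r * coeff w f := rfl

/-- Concatenation product: the coefficient of `w` in `f * g` is the sum of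
`f_u * g_v` over all the factorizations `w = u v`. -/
instance : Mul (NCSeries σ K) :=
  ⟨fun f g => mk fun w =>
    ∑ i ∈ Finset.range (w.length + 1), coeff (w.take i) f * coeff (w.drop i) g⟩

instance : One (NCSeries σ K) := ⟨mk fun w => if w.length = 0 then 1 else 0⟩

theorem coeff_mul (w : List σ) (f g : NCSeries σ K) :
    coeff w (f * g) =
      ∑ i ∈ Finset.range (w.length + 1), coeff (w.take i) f * coeff (w.drop i) g := rfl

theorem coeff_one (w : List σ) :
    coeff w (1 : NCSeries σ K) = if w.length = 0 then 1 else 0 := rfl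

def shift (a : σ) (f : NCSeries σ K) : NCSeries σ K := mk fun w => coeff (a :: w) f

theorem coeff_mul_nil (f g : NCSeries σ K) :
    coeff [] (f * g) = coeff [] f * coeff [] g := by
  simp [coeff_mul]

theorem coeff_mul_cons (a : σ) (w : List σ) (f g : NCSeries σ K) :
    coeff (a :: w) (f * g) =
      coeff (w) (shift a f * g) + coeff [] f * coeff (a :: w) g := by
  simp [coeff_mul, Finset.sum_range_succ' _ (w.length + 1), shift]

theorem shift_mul (a : σ) (f g : NCSeries σ K) :
    shift a (f * g) = shift a f * g + coeff [] f • shift a g := by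
  ext w
  simp [shift, coeff_mul_cons]

theorem add_mul_aux (f g h : NCSeries σ K) : (f + g) * h = f * h + g * h := by
  ext w
  simp [coeff_mul, add_mul, Finset.sum_add_distrib]

theorem mul_add_aux (f g h : NCSeries σ K) : f * (g + h) = f * g + f * h := by
  ext w
  simp [coeff_mul, mul_add, Finset.sum_add_distrib]

theorem smul_mul_aux (r : K) (f g : NCSeries σ K) : (r • f) * g = r • (f * g) := by
  ext w
  simp [coeff_mul, Finset.mul_sum, mul_assoc]

theorem mul_smul_aux (r : K) (f g : NCSeries σ K) : f * (r • g) = r • (f * g) := by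
  ext w
  simp only [coeff_mul, Finset.mul_sum, coeff_smul]
  exact Finset.sum_congr rfl fun _ _ => by ring

theorem mul_assoc_aux (f g h : NCSeries σ K) : f * g * h = f * (g * h) := by
  ext w
  induction w generalizing f with
  | nil => simp [coeff_mul_nil, mul_assoc]
  | cons a w ih =>
    simp only [coeff_mul_cons, shift_mul, add_mul_aux, smul_mul_aux, coeff_add, coeff_smul, ih,
      coeff_mul_nil]
    ring

theorem one_mul_aux (f : NCSeries σ K) : 1 * f = f := by
  ext w
  rw [coeff_mul, Finset.sum_eq_single 0]
  · simp [coeff_one]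
  · intro i hi h0
    have : (w.take i).length ≠ 0 := by
      rw [List.length_take]
      have := Finset.mem_range.1 hi
      omega
    rw [coeff_one, if_neg this, zero_mul]
  · simp

theorem mul_one_aux (f : NCSeries σ K) : f * 1 = f := by
  ext w
  rw [coeff_mul, Finset.sum_eq_single w.length]
  · simp [coeff_one]
  · intro i hi h0
    have : (w.drop i).length ≠ 0 := by
      rw [List.length_drop]
      have := Finset.mem_range.1 hi
      omega
    rw [coeff_one, if_neg this, mul_zero]
  · simp

instance : Ring (NCSeries σ K) :=
  { (inferInstance : AddCommGroup (NCSeries σ K)) with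
    mul := (· * ·)
    one := 1
    left_distrib := mul_add_aux
    right_distrib := add_mul_aux
    zero_mul := fun f => by ext w; simp [coeff_mul]
    mul_zero := fun f => by ext w; simp [coeff_mul]
    mul_assoc := mul_assoc_aux
    one_mul := one_mul_aux
    mul_one := mul_one_aux }

instance : Algebra K (NCSeries σ K) := Algebra.ofModule smul_mul_aux mul_smul_aux

open Classical in
/-- The indeterminate attached to the letter `a`. -/
noncomputable def var (a : σ) : NCSeries σ K := mk fun w => if w = [a] then 1 else 0

/-- `f` is homogeneous of degree `n`: only words of length `n` occur (`0` qualifies). -/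
def IsHomogeneous (f : NCSeries σ K) (n : ℕ) : Prop := ∀ w : List σ, w.length ≠ n → coeff w f = 0

/-- Convergence of a sequence of formal series: every coefficient is eventually constant. -/
def ConvergesTo (s : ℕ → NCSeries σ K) (f : NCSeries σ K) : Prop :=
  ∀ w : List σ, ∀ᶠ N in Filter.atTop, coeff w (s N) = coeff w f

/-- `P` is the infinite ordered product `a 0 * a 1 * a 2 * ⋯`. -/
def IsIncreasingProd (a : ℕ → NCSeries σ K) (P : NCSeries σ K) : Prop :=
  ConvergesTo (fun N => ((List.range N).map a).prod) P

/-- `Q` is the infinite ordered product `⋯ * a 2 * a 1 * a 0`. -/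
def IsDecreasingProd (a : ℕ → NCSeries σ K) (Q : NCSeries σ K) : Prop :=
  ConvergesTo (fun N => ((List.range N).reverse.map a).prod) Q

/-- `Z` is the infinite palindromic product `(a 0 * a 1 * a 2 * ⋯) * (⋯ * a 2 * a 1 * a 0)`. -/
def IsPalindromicProd (a : ℕ → NCSeries σ K) (Z : NCSeries σ K) : Prop :=
  ∃ P Q, IsIncreasingProd a P ∧ IsDecreasingProd a Q ∧ Z = P * Q

end Ring

section Exp

variable {σ : Type*} {K : Type*} [Field K]

/-- The exponential `∑ fⁿ / n!` of a series `f` without constant term. Then `fⁿ` has no words of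
length less than `n`, so that each coefficient is a finite sum; see `convergesTo_exp`. -/
def exp (f : NCSeries σ K) : NCSeries σ K :=
  mk fun w => ∑ n ∈ Finset.range (w.length + 1), (n.factorial : K)⁻¹ * coeff w (f ^ n)

theorem coeff_pow_eq_zero {f : NCSeries σ K} (hf : coeff [] f = 0) (n : ℕ) (w : List σ)
    (hw : w.length < n) : coeff w (f ^ n) = 0 := by
  induction n generalizing w with
  | zero => omega
  | succ n ih =>
    rw [pow_succ', coeff_mul]
    refine Finset.sum_eq_zero fun i _ => ?_
    rcases Nat.eq_zero_or_pos i with rfl | hi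
    · simp [hf]
    · by_cases h : (w.drop i).length < n
      · rw [ih _ h, mul_zero]
      · rw [List.length_drop] at h
        have hnil : w = [] := List.length_eq_zero_iff.1 (by omega)
        simp [hnil, hf]

/-- For a series without constant term, `exp` is the sum of the exponential series. -/
theorem convergesTo_exp {f : NCSeries σ K} (hf : coeff [] f = 0) :
    ConvergesTo (fun N => ∑ n ∈ Finset.range N, (n.factorial : K)⁻¹ • f ^ n) (exp f) := by
  intro w
  have hsum : ∀ N, coeff w (∑ n ∈ Finset.range N, (n.factorial : K)⁻¹ • f ^ n) =
      ∑ n ∈ Finset.range N, (n.factorial : K)⁻¹ * coeff w (f ^ n) := by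
    intro N
    induction N with
    | zero => simp
    | succ N ih => rw [Finset.sum_range_succ, Finset.sum_range_succ, coeff_add, coeff_smul, ih]
  filter_upwards [Filter.eventually_ge_atTop (w.length + 1)] with N hN
  rw [hsum, exp, coeff_mk]
  refine (Finset.sum_subset (Finset.range_mono hN) fun n _ hn => ?_).symm
  rw [coeff_pow_eq_zero hf n w (by simpa using hn), mul_zero]

end Exp

end NCSeries

namespace SymmetricZassenhaus

open NCSeries

/-- The algebra of formal power series in two non-commuting indeterminates over `K`. -/
abbrev Series (K : Type*) : Type _ := NCSeries (Fin 2) K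

variable (K : Type*) [Field K]

/-- The first indeterminate. -/
noncomputable def X : Series K := var 0

/-- The second indeterminate. -/
noncomputable def Y : Series K := var 1

attribute [local instance] LieRing.ofAssociativeRing

/-- The Lie algebra of Lie polynomials in `X` and `Y`: the smallest subspace of the algebra of
formal power series that contains `X` and `Y` and is closed under `[a, b] = a b - b a`. -/
noncomputable def liePolynomials : LieSubalgebra K (Series K) :=
  LieSubalgebra.lieSpan K (Series K) {X K, Y K}

variable {K}

/-- `e^{X+Y} = e^{X/2} e^{Y/2} (a 0 · a 1 · a 2 ⋯) (⋯ a 2 · a 1 · a 0) e^{Y/2} e^{X/2}`. -/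
def FactorsExp (a : ℕ → Series K) : Prop :=
  ∃ Z, IsPalindromicProd a Z ∧
    exp (X K + Y K) =
      exp ((1 / 2 : K) • X K) * exp ((1 / 2 : K) • Y K) * Z *
        exp ((1 / 2 : K) • Y K) * exp ((1 / 2 : K) • X K)

/-- `C 2, C 3, …` are the exponents of a left-right palindromic factorization of `e^{X+Y}`, with
`C n` a homogeneous Lie polynomial of degree `n` (the values `C 0` and `C 1` play no role). -/
structure IsDecomposition (C : ℕ → Series K) : Prop where
  lie : ∀ n, 2 ≤ n → C n ∈ liePolynomials K
  homogeneous : ∀ n, 2 ≤ n → IsHomogeneous (C n) n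
  factors : FactorsExp fun i => exp (C (i + 2))

/-- The `j`-th iterate of `ad_a : b ↦ [a, b] = a b - b a`. -/
def adPow (a : Series K) (j : ℕ) (b : Series K) : Series K := (fun c => ⁅a, c⁆)^[j] b

variable (K)

/-- The initial family `f_{1,ℓ}`. -/
noncomputable def fInit (l : ℕ) : Series K :=
  if l = 0 then (1 / 2 : K) • (X K + Y K)
  else ((-1) ^ l / 2 ^ l : K) •
    ((1 / (2 * (l.factorial : K))) • adPow (Y K) l (X K) +
      ∑ j ∈ Finset.range (l + 1), (1 / ((j.factorial : K) * ((l - j).factorial : K))) •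
        adPow (Y K) (l - j) (adPow (X K) j (Y K)))

/-- The initial family `g_{1,ℓ}`. -/
noncomputable def gInit (l : ℕ) : Series K :=
  if l = 0 then (1 / 2 : K) • (X K + Y K)
  else (1 / ((l.factorial : K) * 2 ^ (l + 1))) • adPow (Y K) l (X K)

variable {K}

/-- `∑_{j=0}^{[ℓ/n]} (s^j / j!) ad_c^j h_{ℓ - n j}`. -/
noncomputable def adSum (s : K) (n : ℕ) (c : Series K) (h : ℕ → Series K) (l : ℕ) : Series K :=
  ∑ j ∈ Finset.range (l / n + 1), (s ^ j / (j.factorial : K)) • adPow c j (h (l - n * j))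

/-- One step of the recursion for all degrees: `h_{n-1,·} ↦ h_{n,·}`, where `c = C_n`; the entry
of index `n - 1` is first corrected by `s n C_n` (`s = -1` for the `f`'s, `s = 1` for the `g`'s). -/
noncomputable def step (s : K) (n : ℕ) (c : Series K) (h : ℕ → Series K) : ℕ → Series K :=
  adSum s n c fun l => if l = n - 1 then h l + (s * (n : K)) • c else h l

/-- `C_k = (f_{k-1,k-1} - g_{k-1,k-1}) / (2 k)` for given families `f_{k-1,·}` and `g_{k-1,·}`. -/
noncomputable def nextTerm (k : ℕ) (fg : (ℕ → Series K) × (ℕ → Series K)) : Series K :=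
  (1 / (2 * (k : K))) • (fg.1 (k - 1) - fg.2 (k - 1))

variable (K)

/-- The families `f_{n,·}` and `g_{n,·}` at index `n = m + 1`. -/
noncomputable def families : ℕ → (ℕ → Series K) × (ℕ → Series K)
  | 0 => (fInit K, gInit K)
  | m + 1 =>
    let c := nextTerm (m + 2) (families m)
    (step (-1) (m + 2) c (families m).1, step 1 (m + 2) c (families m).2)

/-- The exponents generated by the recursion for all degrees, for `k ≥ 2`:
`C_k = (f_{k-1,k-1} - g_{k-1,k-1}) / (2 k)`. -/
noncomputable def term (k : ℕ) : Series K := nextTerm k (families K (k - 2))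

variable {K}

/-- One step of the recursion restricted to odd degrees: `h_{k-2,·} ↦ h_{k,·}`, where `c = C_k`. -/
noncomputable def oddStep (s : K) (k : ℕ) (c : Series K) (h : ℕ → Series K) (l : ℕ) : Series K :=
  if l = k - 1 then (s * (k : K)) • c + h (k - 1) else adSum s k c h l

variable (K)

/-- The families `f_{k,·}` and `g_{k,·}` of the odd recursion at index `k = 2 m + 1`; the
exponent used in the step to `2 m + 3` is
`C_{2m+3} = (f_{2m+1,2m+2} - g_{2m+1,2m+2}) / (2 (2 m + 3))`. -/
noncomputable def oddFamilies : ℕ → (ℕ → Series K) × (ℕ → Series K)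
  | 0 => (fInit K, gInit K)
  | m + 1 =>
    let c := nextTerm (2 * m + 3) (oddFamilies m)
    (oddStep (-1) (2 * m + 3) c (oddFamilies m).1, oddStep 1 (2 * m + 3) c (oddFamilies m).2)

/-- The exponent `C_{2m+3}` generated by the recursion restricted to odd degrees. -/
noncomputable def oddTerm (m : ℕ) : Series K := nextTerm (2 * m + 3) (oddFamilies K m)

end SymmetricZassenhaus

/-!
# The symmetric Zassenhaus formula

The degree of words takes the place of a scaling parameter `t` in `X ↦ t X`, `Y ↦ t Y`: the operator
`t d/dt` becomes the Euler derivation `euler`, and `t ↦ -t` becomes the automorphism `signHom`.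
Divide `e^{X/2}`, `e^{Y/2}`, `e^{C 2}`, …, `e^{C (m + 1)}` out of `e^{X+Y}` on both sides, and call
the quotient `residual C m`.

*Uniqueness.* In a decomposition `residual C m = 1 + O(m + 2)`. Dividing a series of this form by
`e^{C (m + 2)}` on both sides changes its component of degree `m + 2` by `-2 C (m + 2)`
(`coeff_residual_succ`), and must cancel it. So `residual C m`, which depends on the earlier
exponents only, determines `C (m + 2)`.

*Recursion.* The quotient `P = residual C m` satisfies an equation `E P = F P - P G` for the Euler
derivation `E`. Passing to `e^{-c} P e^{-c}` with `c` homogeneous of degree `n` replaces `F` by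
`e^{-c} (F - n c) e^c` and `G` by `e^c (G + n c) e^{-c}` (`euler_exp_neg_mul_mul_exp_neg`). As
`e^c F e^{-c} = ∑ ad_c^j F / j!` (`exp_mul_gather_mul_exp_neg`), these are the recursion steps for
the components of `F` and `G`; the initial families come from `F = X + Y`, `G = 0`, `P = e^{X+Y}`
after division by `e^{X/2}` and `e^{Y/2}`. If `P = 1 + O(N)`, then comparing the components of
degree `N` in `E P = F P - P G` gives `N P_N = F_N - G_N` (`coeff_of_euler_eq`), and so the choice
`2 N C_N = F_N - G_N` makes the next quotient `1 + O(N + 1)`. The exponents so produced are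
homogeneous Lie polynomials since the recursion only forms linear combinations of brackets.

*Parity.* `signHom` inverts `residual C 0`, and it continues to invert the later quotients as long
as only exponents of odd degree occur (`signHom_residual_term_mul`). If `P = 1 + O(N)` is inverted
by `signHom`, then `((-1) ^ N + 1) P_N = 0`, so that exponents of even degree vanish. The steps of
even degree of the recursion are then trivial, which gives the recursion over odd degrees.
-/

namespace NCSeries

attribute [local instance] LieRing.ofAssociativeRing

section Ring

variable {σ : Type*} {K : Type*} [CommRing K]

@[simp] theorem coeff_neg (w : List σ) (f : NCSeries σ K) : coeff w (-f) = -coeff w f := rfl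

@[simp] theorem coeff_sub (w : List σ) (f g : NCSeries σ K) :
    coeff w (f - g) = coeff w f - coeff w g := by
  rw [sub_eq_add_neg, coeff_add, coeff_neg, ← sub_eq_add_neg]

@[simp] theorem coeff_sum {ι : Type*} (s : Finset ι) (w : List σ) (f : ι → NCSeries σ K) :
    coeff w (∑ i ∈ s, f i) = ∑ i ∈ s, coeff w (f i) := by
  classical
  induction s using Finset.induction_on with
  | empty => simp
  | insert a s ha ih => rw [Finset.sum_insert ha, Finset.sum_insert ha, coeff_add, ih]

@[simp] theorem coeff_nil_one : coeff [] (1 : NCSeries σ K) = 1 := by simp [coeff_one]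

/-! ### Homogeneous series -/

namespace IsHomogeneous

variable {f g : NCSeries σ K} {m n : ℕ}

theorem zero (n : ℕ) : IsHomogeneous (0 : NCSeries σ K) n := fun _ _ => rfl

theorem one : IsHomogeneous (1 : NCSeries σ K) 0 := fun w hw => by simp [coeff_one, hw]

theorem add (hf : IsHomogeneous f n) (hg : IsHomogeneous g n) : IsHomogeneous (f + g) n :=
  fun w hw => by simp [hf w hw, hg w hw]

theorem sub (hf : IsHomogeneous f n) (hg : IsHomogeneous g n) : IsHomogeneous (f - g) n :=
  fun w hw => by simp [hf w hw, hg w hw]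

theorem neg (hf : IsHomogeneous f n) : IsHomogeneous (-f) n :=
  fun w hw => by simp [hf w hw]

theorem smul (r : K) (hf : IsHomogeneous f n) : IsHomogeneous (r • f) n :=
  fun w hw => by simp [hf w hw]

theorem sum {ι : Type*} {s : Finset ι} {f : ι → NCSeries σ K}
    (hf : ∀ i ∈ s, IsHomogeneous (f i) n) : IsHomogeneous (∑ i ∈ s, f i) n :=
  fun w hw => by
    rw [coeff_sum]
    exact Finset.sum_eq_zero fun i hi => hf i hi w hw

theorem mul (hf : IsHomogeneous f m) (hg : IsHomogeneous g n) : IsHomogeneous (f * g) (m + n) := by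
  intro w hw
  rw [coeff_mul]
  refine Finset.sum_eq_zero fun i hi => ?_
  have := Finset.mem_range.1 hi
  by_cases h : i = m
  · rw [hg _ (by rw [List.length_drop]; omega), mul_zero]
  · rw [hf _ (by rw [List.length_take]; omega), zero_mul]

theorem pow (hf : IsHomogeneous f n) (k : ℕ) : IsHomogeneous (f ^ k) (n * k) := by
  induction k with
  | zero => simpa using one
  | succ k ih => rw [pow_succ, Nat.mul_succ]; exact ih.mul hf

theorem lie (hf : IsHomogeneous f m) (hg : IsHomogeneous g n) : IsHomogeneous ⁅f, g⁆ (m + n) := by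
  rw [LieRing.of_associative_ring_bracket]
  exact (hf.mul hg).sub (Nat.add_comm n m ▸ hg.mul hf)

theorem coeff_nil (hf : IsHomogeneous f n) (hn : 1 ≤ n) : coeff [] f = 0 :=
  hf [] (by simp; omega)

end IsHomogeneous

theorem isHomogeneous_var (a : σ) : IsHomogeneous (var a : NCSeries σ K) 1 := by
  intro w hw
  have : w ≠ [a] := by rintro rfl; simp at hw
  simp [var, this]

end Ring

/-! ### The filtration by degree -/

section Coefficients

variable {σ : Type*} {K : Type*}

/-- The series `f` and `g` have the same coefficients at all words of length less than `N`, that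
is, they are congruent modulo terms of degree at least `N`. -/
def AgreeBelow (N : ℕ) (f g : NCSeries σ K) : Prop :=
  ∀ w : List σ, w.length < N → coeff w f = coeff w g

namespace AgreeBelow

variable {N : ℕ} {f g h : NCSeries σ K}

theorem refl (N : ℕ) (f : NCSeries σ K) : AgreeBelow N f f := fun _ _ => rfl

theorem symm (h : AgreeBelow N f g) : AgreeBelow N g f := fun w hw => (h w hw).symm

theorem trans (h₁ : AgreeBelow N f g) (h₂ : AgreeBelow N g h) : AgreeBelow N f h :=
  fun w hw => (h₁ w hw).trans (h₂ w hw)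

theorem mono {M : ℕ} (h : AgreeBelow N f g) (hM : M ≤ N) : AgreeBelow M f g :=
  fun w hw => h w (hw.trans_le hM)

end AgreeBelow

theorem coeff_congr_of_agreeBelow {f g : NCSeries σ K} {w : List σ}
    (h : AgreeBelow (w.length + 1) f g) : coeff w f = coeff w g := h w (Nat.lt_succ_self _)

theorem agreeBelow_of_le {s : ℕ → NCSeries σ K} (hs : ∀ N, AgreeBelow (N + 2) (s (N + 1)) (s N))
    {M N : ℕ} (h : N ≤ M) : AgreeBelow (N + 2) (s M) (s N) := by
  induction M, h using Nat.le_induction with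
  | base => exact .refl _ _
  | succ M hM ih => exact ((hs M).mono (by omega)).trans ih

theorem agreeBelow_of_convergesTo {s : ℕ → NCSeries σ K} {f : NCSeries σ K}
    (hs : ∀ N, AgreeBelow (N + 2) (s (N + 1)) (s N)) (hf : ConvergesTo s f) (N : ℕ) :
    AgreeBelow (N + 2) f (s N) := by
  intro w hw
  obtain ⟨M, hM, hNM⟩ := ((hf w).and (Filter.eventually_ge_atTop N)).exists
  rw [← hM, agreeBelow_of_le hs hNM w hw]

theorem exists_convergesTo {s : ℕ → NCSeries σ K}
    (hs : ∀ N, AgreeBelow (N + 2) (s (N + 1)) (s N)) : ∃ f, ConvergesTo s f := by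
  refine ⟨mk fun w => coeff w (s w.length), fun w => ?_⟩
  filter_upwards [Filter.eventually_ge_atTop w.length] with N hN
  exact agreeBelow_of_le hs hN w (by omega)

end Coefficients

section Ring

variable {σ : Type*} {K : Type*} [CommRing K]

namespace AgreeBelow

variable {N : ℕ} {f g f' g' : NCSeries σ K}

theorem mul (h : AgreeBelow N f f') (h' : AgreeBelow N g g') : AgreeBelow N (f * g) (f' * g') := by
  intro w hw
  rw [coeff_mul, coeff_mul]
  refine Finset.sum_congr rfl fun i _ => ?_
  rw [h _ (by rw [List.length_take]; omega), h' _ (by rw [List.length_drop]; omega)]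

theorem one_mul_one (h : AgreeBelow N f 1) (h' : AgreeBelow N g 1) : AgreeBelow N (f * g) 1 := by
  simpa using h.mul h'

end AgreeBelow

/-- For series congruent to `1` modulo terms of degree at least `N`, the components of degree `N`
add up under multiplication. -/
theorem coeff_mul_of_agreeBelow_one {f g : NCSeries σ K} {w : List σ} (hw : 1 ≤ w.length)
    (hf : AgreeBelow w.length f 1) (hg : AgreeBelow w.length g 1) :
    coeff w (f * g) = coeff w f + coeff w g := by
  have key : f * g = f + g - 1 + (f - 1) * (g - 1) := by noncomm_ring
  have hone : coeff w (1 : NCSeries σ K) = 0 := by rw [coeff_one, if_neg (by omega)]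
  have hprod : coeff w ((f - 1) * (g - 1)) = 0 := by
    rw [coeff_mul]
    refine Finset.sum_eq_zero fun i hi => ?_
    have := Finset.mem_range.1 hi
    by_cases h : i = 0
    · rw [coeff_sub, hf _ (by rw [List.length_take]; omega), sub_self, zero_mul]
    · rw [coeff_sub _ g, hg _ (by rw [List.length_drop]; omega), sub_self, mul_zero]
  rw [key, coeff_add, coeff_sub, coeff_add, hone, hprod]
  ring

/-! ### The Euler derivation and the sign automorphism -/

/-- The Euler derivation, which multiplies the component of degree `n` by `n`. It plays the role of
`t d/dt` for a parameter `t` that scales the indeterminates. -/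
def euler (f : NCSeries σ K) : NCSeries σ K := mk fun w => w.length * coeff w f

theorem coeff_euler (w : List σ) (f : NCSeries σ K) : coeff w (euler f) = w.length * coeff w f :=
  rfl

theorem euler_mul (f g : NCSeries σ K) : euler (f * g) = euler f * g + f * euler g := by
  ext w
  simp only [coeff_euler, coeff_mul, coeff_add, ← Finset.sum_add_distrib, Finset.mul_sum]
  refine Finset.sum_congr rfl fun i hi => ?_
  have := Finset.mem_range.1 hi
  have hlen : w.length = (w.take i).length + (w.drop i).length := by
    rw [List.length_take, List.length_drop]; omega
  rw [hlen]
  push_cast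
  ring

/-- The automorphism that multiplies the component of degree `n` by `(-1) ^ n`; it replaces every
indeterminate by its opposite. -/
def signHom : NCSeries σ K →+* NCSeries σ K where
  toFun f := mk fun w => (-1) ^ w.length * coeff w f
  map_one' := by
    ext w
    by_cases h : w.length = 0
    · rw [coeff_mk, h, pow_zero, one_mul]
    · rw [coeff_mk, coeff_one, if_neg h, mul_zero]
  map_mul' f g := by
    ext w
    simp only [coeff_mk, coeff_mul, Finset.mul_sum]
    refine Finset.sum_congr rfl fun i hi => ?_
    have := Finset.mem_range.1 hi
    have hlen : w.length = (w.take i).length + (w.drop i).length := by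
      rw [List.length_take, List.length_drop]; omega
    rw [hlen, pow_add]
    ring
  map_zero' := by ext w; simp
  map_add' f g := by ext w; simp [mul_add]

theorem coeff_signHom (w : List σ) (f : NCSeries σ K) :
    coeff w (signHom f) = (-1) ^ w.length * coeff w f := rfl

theorem IsHomogeneous.signHom_eq {f : NCSeries σ K} {n : ℕ} (hf : IsHomogeneous f n) :
    signHom f = (-1 : K) ^ n • f := by
  ext w
  rw [coeff_signHom, coeff_smul]
  by_cases h : w.length = n
  · rw [h]
  · rw [hf w h, mul_zero, mul_zero]

theorem AgreeBelow.signHom_one {N : ℕ} {f : NCSeries σ K} (hf : AgreeBelow N f 1) :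
    AgreeBelow N (signHom f) 1 := by
  intro w hw
  rw [coeff_signHom, hf w hw, ← coeff_signHom, map_one]

end Ring

/-! ### Sums of homogeneous components -/

section Coefficients

variable {σ : Type*} {K : Type*}

/-- The series `∑ h l`, for a family in which `h l` is homogeneous of degree `l + 1`. The empty
word, where the index `0 - 1` is truncated to `0`, then gets the coefficient `0`. -/
def gather (h : ℕ → NCSeries σ K) : NCSeries σ K := mk fun w => coeff w (h (w.length - 1))

theorem coeff_gather (w : List σ) (h : ℕ → NCSeries σ K) :
    coeff w (gather h) = coeff w (h (w.length - 1)) := rfl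

end Coefficients

section Ring

variable {σ : Type*} {K : Type*} [CommRing K]

/-- Every member `h l` of the family is homogeneous, of degree `l + 1`. -/
def IsGraded (h : ℕ → NCSeries σ K) : Prop := ∀ l, IsHomogeneous (h l) (l + 1)

theorem gather_mul_left {c : NCSeries σ K} {n : ℕ} (hc : IsHomogeneous c n)
    {h : ℕ → NCSeries σ K} (hh : IsGraded h) :
    c * gather h = gather fun l => if n ≤ l then c * h (l - n) else 0 := by
  ext w
  have key : coeff w (c * gather h) = coeff w (c * h (w.length - 1 - n)) ∨ w.length = 0 := by
    by_cases h0 : w.length = 0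
    · exact Or.inr h0
    refine Or.inl ?_
    rw [coeff_mul, coeff_mul]
    refine Finset.sum_congr rfl fun i hi => ?_
    have := Finset.mem_range.1 hi
    by_cases hin : i = n
    · rw [coeff_gather, List.length_drop, hin, Nat.sub_right_comm]
    · rw [hc _ (by rw [List.length_take]; omega), zero_mul, zero_mul]
  have hnil : coeff [] (gather h) = 0 := (hh 0).coeff_nil le_rfl
  rw [coeff_gather]
  rcases key with key | h0
  · split_ifs with hn
    · exact key
    · rw [coeff_zero, coeff_mul]
      refine Finset.sum_eq_zero fun i hi => ?_
      have := Finset.mem_range.1 hi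
      by_cases hin : i = n
      · have : w.drop i = [] := by simp; omega
        rw [this, hnil, mul_zero]
      · rw [hc _ (by rw [List.length_take]; omega), zero_mul]
  · have hw := List.length_eq_zero_iff.1 h0
    subst hw
    rw [coeff_mul_nil, hnil, mul_zero]
    split_ifs with hn
    · rw [coeff_mul_nil, (hh _).coeff_nil (by omega), mul_zero]
    · rfl

theorem gather_mul_right {c : NCSeries σ K} {n : ℕ} (hc : IsHomogeneous c n)
    {h : ℕ → NCSeries σ K} (hh : IsGraded h) :
    gather h * c = gather fun l => if n ≤ l then h (l - n) * c else 0 := by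
  ext w
  have hnil : coeff [] (gather h) = 0 := (hh 0).coeff_nil le_rfl
  rw [coeff_gather, coeff_mul]
  split_ifs with hn
  · rw [coeff_mul]
    refine Finset.sum_congr rfl fun i hi => ?_
    have := Finset.mem_range.1 hi
    by_cases hin : i + n = w.length
    · rcases Nat.eq_zero_or_pos i with rfl | hi0
      · rw [List.take_zero, hnil, (hh _).coeff_nil (by omega), zero_mul]
      · rw [coeff_gather, List.length_take]
        congr 3
        omega
    · rw [hc _ (by rw [List.length_drop]; omega), mul_zero, mul_zero]
  · rw [coeff_zero]
    refine Finset.sum_eq_zero fun i hi => ?_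
    have := Finset.mem_range.1 hi
    by_cases hin : i + n = w.length
    · obtain rfl | rfl : i = 0 ∨ i = 1 := by omega
      · rw [List.take_zero, hnil, zero_mul]
      · omega
    · rw [hc _ (by rw [List.length_drop]; omega), mul_zero]

theorem gather_add (h h' : ℕ → NCSeries σ K) : gather (h + h') = gather h + gather h' := rfl

theorem gather_single {c : NCSeries σ K} {n : ℕ} (hc : IsHomogeneous c (n + 1)) :
    gather (fun l => if l = n then c else 0) = c := by
  ext w
  rw [coeff_gather]
  split_ifs with h
  · rfl
  · rw [hc w (by omega), coeff_zero]

theorem isGraded_single {c : NCSeries σ K} {n : ℕ} (hc : IsHomogeneous c (n + 1)) :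
    IsGraded (fun l => if l = n then c else 0) := by
  intro l
  dsimp only
  split_ifs with h
  · exact h ▸ hc
  · exact .zero _

/-- If `E P = F P - P G` for the Euler derivation `E` and `P = 1` up to terms of degree at least
`|w|`, then `P` has the coefficient `(F_w - G_w) / |w|` at `w`. -/
theorem coeff_of_euler_eq {P F G : NCSeries σ K} (hP : euler P = F * P - P * G)
    (hF : coeff [] F = 0) (hG : coeff [] G = 0) {w : List σ} (hw : AgreeBelow w.length P 1) :
    w.length * coeff w P = coeff w F - coeff w G := by
  have hFP : coeff w (F * P) = coeff w F := by
    rw [coeff_mul, ← mul_one F, coeff_mul]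
    refine Finset.sum_congr rfl fun i hi => ?_
    rcases Nat.eq_zero_or_pos i with rfl | h
    · rw [List.take_zero, mul_one, hF, zero_mul, zero_mul]
    · have := Finset.mem_range.1 hi
      by_cases h1 : 0 < w.length
      · rw [hw _ (by rw [List.length_drop]; omega), mul_one]
      · omega
  have hPG : coeff w (P * G) = coeff w G := by
    rw [coeff_mul, ← one_mul G, coeff_mul]
    refine Finset.sum_congr rfl fun i hi => ?_
    have := Finset.mem_range.1 hi
    by_cases h : i = w.length
    · rw [h, List.drop_length, one_mul, hG, mul_zero, mul_zero]
    · rw [hw _ (by rw [List.length_take]; omega), one_mul]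
  rw [← coeff_euler, hP, coeff_sub, hFP, hPG]

end Ring

/-! ### Exponentials of homogeneous series -/

section Exp

variable {σ : Type*} {K : Type*} [Field K]

theorem exp_zero : exp (0 : NCSeries σ K) = 1 := by
  ext w
  rw [exp, coeff_mk, Finset.sum_eq_single 0]
  · simp
  · intro n _ hn
    rw [zero_pow hn, coeff_zero, mul_zero]
  · simp

theorem coeff_nil_exp (f : NCSeries σ K) : coeff [] (exp f) = 1 := by
  simp [exp]

theorem signHom_exp (f : NCSeries σ K) : signHom (exp f) = exp (signHom f) := by
  ext w
  rw [coeff_signHom, exp, exp, coeff_mk, coeff_mk, Finset.mul_sum]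
  refine Finset.sum_congr rfl fun n _ => ?_
  rw [← map_pow, coeff_signHom]
  ring

theorem agreeBelow_expSum {f : NCSeries σ K} (hf : coeff [] f = 0) (N : ℕ) :
    AgreeBelow N (exp f) (∑ n ∈ Finset.range N, (n.factorial : K)⁻¹ • f ^ n) := by
  intro w hw
  simp only [coeff_sum, exp, coeff_mk, coeff_smul]
  refine Finset.sum_subset (Finset.range_mono (by omega)) fun n _ hn => ?_
  rw [coeff_pow_eq_zero hf n w (by simpa using hn), mul_zero]

theorem commute_exp {f : NCSeries σ K} (hf : coeff [] f = 0) : Commute f (exp f) := by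
  ext w
  have h := agreeBelow_expSum hf (w.length + 1)
  rw [coeff_congr_of_agreeBelow ((AgreeBelow.refl _ f).mul h),
    coeff_congr_of_agreeBelow (h.mul (AgreeBelow.refl _ f)), Finset.mul_sum, Finset.sum_mul]
  simp only [mul_smul_comm, smul_mul_assoc, (Commute.self_pow f _).eq]

theorem exp_agreeBelow_one {f : NCSeries σ K} {n : ℕ} (hf : IsHomogeneous f n) :
    AgreeBelow n (exp f) 1 := by
  intro w hw
  rw [exp, coeff_mk, Finset.sum_eq_single 0]
  · simp
  · intro k _ hk
    rw [hf.pow k w (by have := Nat.le_mul_of_pos_right n (Nat.pos_of_ne_zero hk); omega), mul_zero]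
  · simp

theorem coeff_exp_of_length {f : NCSeries σ K} {n : ℕ} (hn : 1 ≤ n) (hf : IsHomogeneous f n)
    {w : List σ} (hw : w.length = n) : coeff w (exp f) = coeff w f := by
  rw [exp, coeff_mk, Finset.sum_eq_single 1]
  · simp
  · intro k _ hk
    rw [hf.pow k w fun h => hk (by rw [hw] at h; nlinarith), mul_zero]
  · intro h
    rw [Finset.mem_range] at h
    omega

variable [CharZero K]

theorem euler_exp {f : NCSeries σ K} {n : ℕ} (hn : 1 ≤ n) (hf : IsHomogeneous f n) :
    euler (exp f) = ((n : K) • f) * exp f := by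
  ext w
  have h := agreeBelow_expSum (hf.coeff_nil hn) (w.length + 1)
  have hlen : ∀ k, (w.length : K) * coeff w (f ^ k) = (n * k : ℕ) * coeff w (f ^ k) := by
    intro k
    by_cases hk : w.length = n * k
    · rw [hk]
    · rw [hf.pow k w hk, mul_zero, mul_zero]
  rw [coeff_euler, coeff_congr_of_agreeBelow h,
    coeff_congr_of_agreeBelow ((AgreeBelow.refl _ _).mul h), Finset.mul_sum]
  simp only [coeff_sum, coeff_smul, mul_smul_comm, smul_mul_assoc, ← pow_succ', Finset.mul_sum]
  have hlast : coeff w (f ^ (w.length + 1)) = 0 :=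
    coeff_pow_eq_zero (hf.coeff_nil hn) _ w (Nat.lt_succ_self _)
  rw [Finset.sum_range_succ', Finset.sum_range_succ _ w.length, hlast]
  have h0 := hlen 0
  simp only [Nat.mul_zero, Nat.cast_zero, zero_mul] at h0
  have hz : (w.length : K) * (((Nat.factorial 0 : ℕ) : K)⁻¹ * coeff w (f ^ 0)) = 0 := by
    rw [mul_left_comm, h0, mul_zero]
  rw [hz, mul_zero, mul_zero]
  congr 1
  refine Finset.sum_congr rfl fun k _ => ?_
  rw [mul_left_comm, hlen, Nat.factorial_succ]
  have h1 : ((k : K) + 1) ≠ 0 := by exact_mod_cast Nat.succ_ne_zero k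
  have h2 : ((k.factorial : ℕ) : K) ≠ 0 := by exact_mod_cast Nat.factorial_ne_zero k
  push_cast
  field_simp

theorem eq_one_of_euler_eq_zero {f : NCSeries σ K} (h0 : coeff [] f = 1) (h : euler f = 0) :
    f = 1 := by
  ext w
  by_cases hw : w.length = 0
  · rw [List.length_eq_zero_iff.1 hw, h0, coeff_nil_one]
  · have := congrArg (coeff w) h
    rw [coeff_euler, coeff_zero, mul_eq_zero] at this
    rw [coeff_one, if_neg hw]
    exact this.resolve_left (by exact_mod_cast hw)

theorem exp_mul_exp_neg {f : NCSeries σ K} {n : ℕ} (hn : 1 ≤ n) (hf : IsHomogeneous f n) :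
    exp f * exp (-f) = 1 := by
  apply eq_one_of_euler_eq_zero
  · rw [coeff_mul_nil, coeff_nil_exp, coeff_nil_exp, mul_one]
  · have hc := (commute_exp (hf.coeff_nil hn)).eq
    rw [euler_mul, euler_exp hn hf, euler_exp hn hf.neg, smul_mul_assoc, hc]
    simp [mul_assoc]

theorem exp_neg_mul_exp {f : NCSeries σ K} {n : ℕ} (hn : 1 ≤ n) (hf : IsHomogeneous f n) :
    exp (-f) * exp f = 1 := by
  simpa using exp_mul_exp_neg hn hf.neg

end Exp

end NCSeries

/-! ### Conjugation by an exponential -/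

namespace SymmetricZassenhaus

open NCSeries

attribute [local instance] LieRing.ofAssociativeRing

section Conjugation

variable {K : Type*} [Field K]

theorem adPow_zero (a b : Series K) : adPow a 0 b = b := rfl

theorem adPow_succ (a : Series K) (j : ℕ) (b : Series K) :
    adPow a (j + 1) b = ⁅a, adPow a j b⁆ := Function.iterate_succ_apply' _ _ _

theorem adPow_zero_left {j : ℕ} (hj : j ≠ 0) (b : Series K) : adPow 0 j b = 0 := by
  obtain ⟨i, rfl⟩ := Nat.exists_eq_succ_of_ne_zero hj
  rw [adPow_succ, zero_lie]

theorem adPow_zero_right (a : Series K) (j : ℕ) : adPow a j 0 = 0 := by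
  induction j with
  | zero => rfl
  | succ j ih => rw [adPow_succ, ih, lie_zero]

theorem adPow_smul_left (s : K) (a : Series K) (j : ℕ) (b : Series K) :
    adPow (s • a) j b = s ^ j • adPow a j b := by
  induction j with
  | zero => rw [pow_zero, one_smul, adPow_zero, adPow_zero]
  | succ j ih => rw [adPow_succ, adPow_succ, ih, smul_lie, lie_smul, smul_smul, pow_succ']

theorem adPow_add_right (a : Series K) (j : ℕ) (b b' : Series K) :
    adPow a j (b + b') = adPow a j b + adPow a j b' := by
  induction j with
  | zero => rfl
  | succ j ih => rw [adPow_succ, adPow_succ, adPow_succ, ih, lie_add]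

theorem adPow_smul_right (s : K) (a : Series K) (j : ℕ) (b : Series K) :
    adPow a j (s • b) = s • adPow a j b := by
  induction j with
  | zero => rfl
  | succ j ih => rw [adPow_succ, adPow_succ, ih, lie_smul]

theorem adPow_smul_self (s : K) (a : Series K) {j : ℕ} (hj : j ≠ 0) : adPow a j (s • a) = 0 := by
  induction j with
  | zero => exact absurd rfl hj
  | succ j ih =>
    rw [adPow_succ]
    by_cases h : j = 0
    · rw [h, adPow_zero, lie_smul, lie_self, smul_zero]
    · rw [ih h, lie_zero]

theorem adPow_mem {a b : Series K} (ha : a ∈ liePolynomials K) (hb : b ∈ liePolynomials K)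
    (j : ℕ) : adPow a j b ∈ liePolynomials K := by
  induction j with
  | zero => exact hb
  | succ j ih => rw [adPow_succ]; exact (liePolynomials K).lie_mem ha ih

theorem isHomogeneous_adPow {a b : Series K} {m n : ℕ} (ha : IsHomogeneous a n)
    (hb : IsHomogeneous b m) (j : ℕ) : IsHomogeneous (adPow a j b) (n * j + m) := by
  induction j with
  | zero => rwa [Nat.mul_zero, Nat.zero_add]
  | succ j ih =>
    rw [adPow_succ, Nat.mul_succ, Nat.add_right_comm, Nat.add_comm]
    exact ha.lie ih

/-- Left and right multiplications commute, so that powers of `ad` expand binomially. -/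
theorem adPow_eq_sum (a : Series K) (j : ℕ) (b : Series K) :
    adPow a j b =
      ∑ p ∈ Finset.HasAntidiagonal.antidiagonal j, (j.choose p.1 : K) • (a ^ p.1 * b * (-a) ^ p.2) := by
  have hpow : adPow a j b = ((LinearMap.mulLeft K a + LinearMap.mulRight K (-a)) ^ j) b := by
    induction j with
    | zero => rfl
    | succ j ih =>
      rw [adPow_succ, ih, pow_succ', Module.End.mul_apply, LieRing.of_associative_ring_bracket,
        LinearMap.add_apply, LinearMap.mulLeft_apply, LinearMap.mulRight_apply, mul_neg,
        sub_eq_add_neg]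
  rw [hpow, Commute.add_pow' (LinearMap.commute_mulLeft_right (R := K) a (-a)), LinearMap.sum_apply]
  refine Finset.sum_congr rfl fun p _ => ?_
  rw [LinearMap.smul_apply, LinearMap.pow_mulLeft, LinearMap.pow_mulRight, Module.End.mul_apply,
    LinearMap.mulLeft_apply, LinearMap.mulRight_apply, Nat.cast_smul_eq_nsmul, mul_assoc]

theorem adPow_gather {c : Series K} {n : ℕ} (hc : IsHomogeneous c n) {h : ℕ → Series K}
    (hh : IsGraded h) (j : ℕ) :
    adPow c j (gather h) =
      gather fun l => if n * j ≤ l then adPow c j (h (l - n * j)) else 0 := by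
  induction j with
  | zero => simp [adPow_zero]
  | succ j ih =>
    have hg : IsGraded fun l => if n * j ≤ l then adPow c j (h (l - n * j)) else 0 := by
      intro l
      dsimp only
      split_ifs with hl
      · have := isHomogeneous_adPow hc (hh (l - n * j)) j
        rwa [show n * j + (l - n * j + 1) = l + 1 by omega] at this
      · exact .zero _
    rw [adPow_succ, ih, LieRing.of_associative_ring_bracket, gather_mul_left hc hg,
      gather_mul_right hc hg]
    ext w
    simp only [coeff_sub, coeff_gather]
    rw [← coeff_sub]
    congr 1
    rw [Nat.mul_succ]
    by_cases h1 : n ≤ w.length - 1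
    · by_cases h2 : n * j ≤ w.length - 1 - n
      · rw [if_pos h1, if_pos h1, if_pos h2, if_pos (by omega), adPow_succ,
          LieRing.of_associative_ring_bracket, Nat.sub_sub, Nat.add_comm n]
      · rw [if_pos h1, if_pos h1, if_neg h2, if_neg (by omega), mul_zero, zero_mul, sub_zero]
    · rw [if_neg h1, if_neg h1, if_neg (by omega), sub_zero]

variable [CharZero K]

/-- `e^d F e^{-d} = ∑ ad_d^j F / j!` coefficientwise. -/
theorem coeff_exp_mul_mul_exp_neg {d : Series K} (hd : coeff [] d = 0) (F : Series K)
    (w : List (Fin 2)) :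
    coeff w (exp d * F * exp (-d)) =
      ∑ j ∈ Finset.range (w.length + 1), (j.factorial : K)⁻¹ * coeff w (adPow d j F) := by
  set N := w.length + 1 with hN
  have hd' : coeff [] (-d) = 0 := by rw [coeff_neg, hd, neg_zero]
  have h := ((agreeBelow_expSum hd N).mul (.refl N F)).mul (agreeBelow_expSum hd' N)
  rw [coeff_congr_of_agreeBelow h, Finset.sum_mul, Finset.sum_mul_sum, ← Finset.sum_product']
  -- a product with `i + k ≥ N` factors without constant term has no words of length below `N`
  have hlow : ∀ {i k : ℕ}, N ≤ i + k → coeff w (d ^ i * F * (-d) ^ k) = 0 := by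
    intro i k hik
    rw [coeff_mul]
    refine Finset.sum_eq_zero fun a ha => ?_
    have ha := Finset.mem_range.1 ha
    by_cases hka : (w.drop a).length < k
    · rw [coeff_pow_eq_zero hd' k _ hka, mul_zero]
    · rw [coeff_mul, Finset.sum_eq_zero, zero_mul]
      intro b hb
      have hb := Finset.mem_range.1 hb
      rw [List.length_drop] at hka
      rw [List.length_take] at hb
      rw [coeff_pow_eq_zero hd i _ (by rw [List.length_take, List.length_take]; omega), zero_mul]
  rw [coeff_sum, ← Finset.sum_filter_of_ne (p := fun p => p.1 + p.2 < N),
    ← Finset.sum_fiberwise_of_maps_to (t := Finset.range N) (g := fun p => p.1 + p.2)]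
  · refine Finset.sum_congr rfl fun j hj => ?_
    have hj := Finset.mem_range.1 hj
    have hfib : Finset.filter (fun p : ℕ × ℕ => p.1 + p.2 = j)
        (Finset.filter (fun p : ℕ × ℕ => p.1 + p.2 < N) (Finset.range N ×ˢ Finset.range N)) =
        Finset.HasAntidiagonal.antidiagonal j := by
      ext p
      simp only [Finset.mem_filter, Finset.mem_product, Finset.mem_range,
        Finset.HasAntidiagonal.mem_antidiagonal]
      omega
    rw [hfib, adPow_eq_sum, coeff_sum, Finset.mul_sum]
    refine Finset.sum_congr rfl fun p hp => ?_
    have hp := Finset.HasAntidiagonal.mem_antidiagonal.1 hp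
    have hfac : ((p.1.factorial : K)⁻¹ * (p.2.factorial : K)⁻¹) =
        (j.factorial : K)⁻¹ * (j.choose p.1 : K) := by
      have h1 : (p.1.factorial : K) ≠ 0 := by exact_mod_cast Nat.factorial_ne_zero _
      have h2 : (p.2.factorial : K) ≠ 0 := by exact_mod_cast Nat.factorial_ne_zero _
      have h3 : (j.factorial : K) ≠ 0 := by exact_mod_cast Nat.factorial_ne_zero _
      have hch : (j.choose p.1 : K) * p.1.factorial * p.2.factorial = j.factorial := by
        rw [← hp, Nat.choose_symm_add]
        exact_mod_cast Nat.add_choose_mul_factorial_mul_factorial p.1 p.2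
      field_simp
      rw [← hch]
      ring
    simp only [smul_mul_assoc, mul_smul_comm, coeff_smul]
    rw [← mul_assoc, ← mul_assoc, ← hfac]
    ring
  · intro p hp
    exact Finset.mem_range.2 (Finset.mem_filter.1 hp).2
  · intro p _ hp
    by_contra hlt
    refine hp ?_
    simp only [smul_mul_assoc, mul_smul_comm, coeff_smul]
    rw [hlow (not_lt.1 hlt), mul_zero, mul_zero]

/-- `adSum s n c` describes the conjugation by `e^{s c}` in terms of homogeneous components. -/
theorem exp_mul_gather_mul_exp_neg {c : Series K} {n : ℕ} (hn : 1 ≤ n) (hc : IsHomogeneous c n)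
    {h : ℕ → Series K} (hh : IsGraded h) (s : K) :
    exp (s • c) * gather h * exp (-(s • c)) = gather (adSum s n c h) := by
  ext w
  rw [coeff_exp_mul_mul_exp_neg ((hc.smul s).coeff_nil hn), coeff_gather, adSum, coeff_sum]
  refine (Finset.sum_subset_zero_on_sdiff (Finset.range_mono ?_) ?_ ?_).symm
  · exact Nat.succ_le_succ ((Nat.div_le_self _ _).trans (Nat.sub_le _ _))
  · intro j hj
    rw [Finset.mem_sdiff, Finset.mem_range, Finset.mem_range, not_lt, Nat.succ_le_iff,
      Nat.div_lt_iff_lt_mul hn, Nat.mul_comm] at hj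
    rw [adPow_smul_left, adPow_gather hc hh, coeff_smul, coeff_gather, if_neg (not_le.2 hj.2),
      coeff_zero, mul_zero, mul_zero]
  · intro j hj
    rw [Finset.mem_range, Nat.lt_succ_iff, Nat.le_div_iff_mul_le hn, Nat.mul_comm] at hj
    rw [adPow_smul_left, adPow_gather hc hh, coeff_smul, coeff_smul, coeff_gather, if_pos hj,
      div_eq_mul_inv]
    ring

end Conjugation

end SymmetricZassenhaus

namespace SymmetricZassenhaus

open NCSeries

attribute [local instance] LieRing.ofAssociativeRing

/-! ### The families of the recursion -/

section Families

variable {K : Type*} [Field K]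

/-- Every `h l` is a Lie polynomial that is homogeneous of degree `l + 1`. -/
def IsLieGraded (h : ℕ → Series K) : Prop :=
  ∀ l, h l ∈ liePolynomials K ∧ IsHomogeneous (h l) (l + 1)

theorem IsLieGraded.isGraded {h : ℕ → Series K} (hh : IsLieGraded h) : IsGraded h :=
  fun l => (hh l).2

theorem X_mem : X K ∈ liePolynomials K := LieSubalgebra.subset_lieSpan (by simp)

theorem Y_mem : Y K ∈ liePolynomials K := LieSubalgebra.subset_lieSpan (by simp)

theorem isHomogeneous_X : IsHomogeneous (X K) 1 := isHomogeneous_var 0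

theorem isHomogeneous_Y : IsHomogeneous (Y K) 1 := isHomogeneous_var 1

theorem sum_mem_liePolynomials {ι : Type*} {s : Finset ι} {f : ι → Series K}
    (hf : ∀ i ∈ s, f i ∈ liePolynomials K) : ∑ i ∈ s, f i ∈ liePolynomials K :=
  (liePolynomials K).toSubmodule.sum_mem hf

theorem smul_mem_liePolynomials (r : K) {f : Series K} (hf : f ∈ liePolynomials K) :
    r • f ∈ liePolynomials K :=
  (liePolynomials K).toSubmodule.smul_mem r hf

theorem isLieGraded_step {c : Series K} {n : ℕ} (hn : 1 ≤ n) (hc : c ∈ liePolynomials K)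
    (hc' : IsHomogeneous c n) {h : ℕ → Series K} (hh : IsLieGraded h) (s : K) :
    IsLieGraded (step s n c h) := by
  have hcor : IsLieGraded fun l => if l = n - 1 then h l + (s * (n : K)) • c else h l := by
    intro l
    dsimp only
    split_ifs with hl
    · refine ⟨(liePolynomials K).add_mem (hh l).1 (smul_mem_liePolynomials _ hc),
        (hh l).2.add ?_⟩
      rw [hl, Nat.sub_add_cancel hn]
      exact hc'.smul _
    · exact hh l
  intro l
  rw [step, adSum]
  refine ⟨sum_mem_liePolynomials fun j _ =>
    smul_mem_liePolynomials _ (adPow_mem hc (hcor _).1 j), IsHomogeneous.sum fun j hj => ?_⟩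
  rw [Finset.mem_range, Nat.lt_succ_iff, Nat.le_div_iff_mul_le hn, Nat.mul_comm] at hj
  have := isHomogeneous_adPow hc' (hcor (l - n * j)).2 j
  rw [← Nat.add_assoc, Nat.add_sub_cancel' hj] at this
  exact this.smul _

theorem adSum_one (s : K) (c : Series K) (h : ℕ → Series K) (l : ℕ) :
    adSum s 1 c h l =
      ∑ j ∈ Finset.range (l + 1), (s ^ j / (j.factorial : K)) • adPow c j (h (l - j)) := by
  simp only [adSum, Nat.div_one, one_mul]

theorem adSum_one_single (s : K) (c : Series K) {h : ℕ → Series K} (hh : ∀ l, l ≠ 0 → h l = 0)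
    (l : ℕ) : adSum s 1 c h l = (s ^ l / (l.factorial : K)) • adPow c l (h 0) := by
  rw [adSum_one, Finset.sum_eq_single l, Nat.sub_self]
  · intro j hj hjl
    have := Finset.mem_range.1 hj
    rw [hh _ (by omega), adPow_zero_right, smul_zero]
  · simp

theorem adSum_zero_left {n : ℕ} (s : K) (h : ℕ → Series K) : adSum s n 0 h = h := by
  funext l
  rw [adSum, Finset.sum_eq_single 0]
  · simp [adPow_zero]
  · intro j _ hj
    rw [adPow_zero_left hj, smul_zero]
  · simp

theorem step_zero_left (s : K) (n : ℕ) (h : ℕ → Series K) : step s n 0 h = h := by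
  simp [step, adSum_zero_left]

/-- The two forms of the recursion step agree: the correction of the entry of index `k - 1` by a
multiple of `c` is killed by `ad_c`, so that it only shows in the entry of index `k - 1` itself. -/
theorem oddStep_eq_step (s : K) {k : ℕ} (hk : 1 ≤ k) (c : Series K) (h : ℕ → Series K) :
    oddStep s k c h = step s k c h := by
  funext l
  rw [oddStep]
  split_ifs with hl
  · have hdiv : l / k = 0 := Nat.div_eq_of_lt (by omega)
    rw [step, adSum, hdiv, zero_add, Finset.sum_range_one, mul_zero, Nat.sub_zero, if_pos hl, hl,
      adPow_zero, pow_zero, Nat.factorial_zero, Nat.cast_one, div_one, one_smul, add_comm]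
  · rw [step, adSum, adSum]
    refine Finset.sum_congr rfl fun j _ => ?_
    congr 1
    split_ifs with hj
    · have hj0 : j ≠ 0 := by rintro rfl; simp at hj; exact hl hj
      rw [adPow_add_right, adPow_smul_self _ _ hj0, add_zero]
    · rfl

variable [CharZero K]

/-- The initial family `f_1` arises from `X + Y` by two steps of degree one, with exponents `X / 2`
and `Y / 2`. -/
theorem fInit_eq_step : fInit K = step (-1) 1 ((1 / 2 : K) • Y K)
    (step (-1) 1 ((1 / 2 : K) • X K) fun l => if l = 0 then X K + Y K else 0) := by
  -- the step for `X / 2`, where the correction term `-X / 2` only survives at `l = 0`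
  have hinner : ∀ l, step (-1) 1 ((1 / 2 : K) • X K) (fun l => if l = 0 then X K + Y K else 0) l =
      (((-1) ^ l / 2 ^ l : K) * (1 / (l.factorial : K))) • adPow (X K) l (Y K) +
        if l = 0 then (1 / 2 : K) • X K else 0 := by
    intro l
    rw [step, adSum_one_single _ _ (by intro l hl; simp [hl])]
    rw [if_pos rfl, if_pos rfl, adPow_smul_left]
    have hXY : X K + Y K + ((-1 : K) * ((1 : ℕ) : K)) • (1 / 2 : K) • X K =
        (1 / 2 : K) • X K + Y K := by module
    rw [hXY, adPow_add_right, smul_smul]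
    by_cases hl : l = 0
    · subst hl
      simp [adPow_zero, add_comm]
    · rw [if_neg hl, adPow_smul_self _ _ hl, zero_add, add_zero]
      congr 1
      rw [one_div, inv_pow]
      ring
  have hzero : step (-1) 1 ((1 / 2 : K) • X K) (fun l => if l = 0 then X K + Y K else 0) 0 +
      ((-1 : K) * ((1 : ℕ) : K)) • (1 / 2 : K) • Y K =
      (1 / 2 : K) • X K + (1 / 2 : K) • Y K := by
    rw [hinner, if_pos rfl, adPow_zero, pow_zero, pow_zero, Nat.factorial_zero, Nat.cast_one]
    module
  funext l
  rw [step, adSum_one, fInit]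
  by_cases hl : l = 0
  · subst hl
    rw [if_pos rfl, Finset.sum_range_one, Nat.sub_self, if_pos rfl, hzero, adPow_zero, pow_zero,
      Nat.factorial_zero, Nat.cast_one, div_one, one_smul, smul_add]
  · rw [if_neg hl]
    -- the summand `j = l` of the step for `Y / 2` is where `ad_Y^l X` comes from
    have hterm : ∀ j ∈ Finset.range (l + 1),
        ((-1 : K) ^ j / (j.factorial : K)) • adPow ((1 / 2 : K) • Y K) j
          (if l - j = 1 - 1 then
            step (-1) 1 ((1 / 2 : K) • X K) (fun l => if l = 0 then X K + Y K else 0) (l - j) +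
              ((-1 : K) * ((1 : ℕ) : K)) • (1 / 2 : K) • Y K
          else step (-1) 1 ((1 / 2 : K) • X K) (fun l => if l = 0 then X K + Y K else 0) (l - j)) =
        ((-1) ^ l / 2 ^ l : K) • (1 / (((l - j).factorial : K) * (j.factorial : K))) •
            adPow (Y K) j (adPow (X K) (l - j) (Y K)) +
          if j = l then ((-1) ^ l / 2 ^ l : K) • (1 / (2 * (l.factorial : K))) • adPow (Y K) l (X K)
          else 0 := by
      intro j hj
      have hj := Nat.lt_succ_iff.1 (Finset.mem_range.1 hj)
      rw [adPow_smul_left]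
      by_cases hjl : j = l
      · subst hjl
        have h2 : adPow (Y K) j (Y K) = 0 := by simpa using adPow_smul_self (1 : K) (Y K) hl
        rw [Nat.sub_self, if_pos rfl, if_pos rfl, hzero, adPow_add_right, adPow_smul_right,
          adPow_smul_right, h2, smul_zero, add_zero, adPow_zero, h2,
          smul_zero, smul_zero, zero_add, smul_smul, smul_smul, smul_smul]
        congr 1
        rw [one_div, inv_pow]
        field_simp
      · have hlj : l - j ≠ 0 := by omega
        rw [Nat.sub_self, if_neg hlj, if_neg hjl, hinner, if_neg hlj, add_zero, add_zero,
          adPow_smul_right, smul_smul, smul_smul, smul_smul]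
        congr 1
        have hp : ((-1) ^ l / 2 ^ l : K) =
            ((-1) ^ j / 2 ^ j) * ((-1) ^ (l - j) / 2 ^ (l - j)) := by
          rw [← div_pow, ← div_pow, ← div_pow, ← pow_add, Nat.add_sub_cancel' hj]
        rw [hp, one_div, inv_pow]
        field_simp
    rw [Finset.sum_congr rfl hterm, Finset.sum_add_distrib, Finset.sum_ite_eq',
      if_pos (by simp), smul_add, add_comm, ← Finset.smul_sum]
    congr 2
    rw [← Finset.sum_range_reflect]
    refine Finset.sum_congr rfl fun j hj => ?_
    have hj := Nat.lt_succ_iff.1 (Finset.mem_range.1 hj)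
    rw [Nat.add_sub_cancel, Nat.sub_sub_self hj]

/-- The initial family `g_1` arises from `0` by two steps of degree one, with exponents `X / 2` and
`Y / 2`. -/
theorem gInit_eq_step : gInit K = step 1 1 ((1 / 2 : K) • Y K)
    (step 1 1 ((1 / 2 : K) • X K) fun _ => 0) := by
  have hinner : ∀ l, step 1 1 ((1 / 2 : K) • X K) (fun _ => 0) l =
      if l = 0 then (1 / 2 : K) • X K else 0 := by
    intro l
    rw [step, adSum_one_single _ _ (by intro l hl; simp [hl])]
    by_cases hl : l = 0
    · subst hl
      simp [adPow_zero]
    · rw [if_neg hl, if_pos rfl, zero_add, adPow_smul_self _ _ hl, smul_zero]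
  funext l
  rw [step, adSum_one_single _ _ (by intro l hl; rw [if_neg (by omega), hinner, if_neg hl]), gInit, if_pos rfl,
    hinner, if_pos rfl, adPow_add_right, adPow_smul_left]
  by_cases hl : l = 0
  · subst hl
    simp [adPow_zero]
  · rw [if_neg hl, smul_smul _ _ (Y K), adPow_smul_left, adPow_smul_right]
    rw [show adPow (Y K) l (((1 : K) * ((1 : ℕ) : K) * (1 / 2)) • Y K) = 0 from
      adPow_smul_self _ _ hl, smul_zero, add_zero, smul_smul, smul_smul]
    congr 1
    rw [one_pow, one_div (2 : K), inv_pow, pow_succ]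
    field_simp

theorem isLieGraded_families (m : ℕ) :
    IsLieGraded (families K m).1 ∧ IsLieGraded (families K m).2 ∧
      term K (m + 2) ∈ liePolynomials K ∧ IsHomogeneous (term K (m + 2)) (m + 2) := by
  have hterm : ∀ m, IsLieGraded (families K m).1 → IsLieGraded (families K m).2 →
      term K (m + 2) ∈ liePolynomials K ∧ IsHomogeneous (term K (m + 2)) (m + 2) := by
    intro m h1 h2
    exact ⟨smul_mem_liePolynomials _ ((liePolynomials K).sub_mem (h1 _).1 (h2 _).1),
      ((h1 (m + 1)).2.sub (h2 (m + 1)).2).smul _⟩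
  induction m with
  | zero =>
    have hX := smul_mem_liePolynomials (1 / 2 : K) (X_mem (K := K))
    have hY := smul_mem_liePolynomials (1 / 2 : K) (Y_mem (K := K))
    have hX' := (isHomogeneous_X (K := K)).smul (1 / 2 : K)
    have hY' := (isHomogeneous_Y (K := K)).smul (1 / 2 : K)
    have h1 : IsLieGraded (fInit K) := by
      rw [fInit_eq_step]
      refine isLieGraded_step le_rfl hY hY' (isLieGraded_step le_rfl hX hX' ?_ _) _
      intro l
      dsimp only
      split_ifs with hl
      · exact ⟨(liePolynomials K).add_mem X_mem Y_mem, hl ▸ isHomogeneous_X.add isHomogeneous_Y⟩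
      · exact ⟨(liePolynomials K).zero_mem, .zero _⟩
    have h2 : IsLieGraded (gInit K) := by
      rw [gInit_eq_step]
      exact isLieGraded_step le_rfl hY hY' (isLieGraded_step le_rfl hX hX'
        (fun l => ⟨(liePolynomials K).zero_mem, .zero _⟩) _) _
    exact ⟨h1, h2, hterm 0 h1 h2⟩
  | succ m ih =>
    obtain ⟨h1, h2, hc, hc'⟩ := ih
    have h1' : IsLieGraded (families K (m + 1)).1 := isLieGraded_step (by omega) hc hc' h1 _
    have h2' : IsLieGraded (families K (m + 1)).2 := isLieGraded_step (by omega) hc hc' h2 _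
    exact ⟨h1', h2', hterm _ h1' h2'⟩

end Families

/-! ### The residual factors -/

section Residual

variable {K : Type*} [Field K]

/-- What remains of `e^{X+Y}` after the outer factors `e^{X/2}`, `e^{Y/2}`, `e^{C 2}`, …,
`e^{C (m + 1)}` have been divided out on both sides. -/
noncomputable def residual (C : ℕ → Series K) : ℕ → Series K
  | 0 => exp (-((1 / 2 : K) • Y K)) * (exp (-((1 / 2 : K) • X K)) * exp (X K + Y K) *
      exp (-((1 / 2 : K) • X K))) * exp (-((1 / 2 : K) • Y K))
  | m + 1 => exp (-C (m + 2)) * residual C m * exp (-C (m + 2))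

theorem isHomogeneous_half_X : IsHomogeneous ((1 / 2 : K) • X K) 1 := isHomogeneous_X.smul _

theorem isHomogeneous_half_Y : IsHomogeneous ((1 / 2 : K) • Y K) 1 := isHomogeneous_Y.smul _

theorem residual_congr {C C' : ℕ → Series K} {m : ℕ} (h : ∀ k, 2 ≤ k → k < m + 2 → C k = C' k) :
    residual C m = residual C' m := by
  induction m with
  | zero => rfl
  | succ m ih =>
    rw [residual, residual, ih fun k hk hkm => h k hk (by omega), h (m + 2) (by omega) (by omega)]

theorem coeff_residual_succ {C : ℕ → Series K} {m : ℕ} (hC : IsHomogeneous (C (m + 2)) (m + 2))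
    (hR : AgreeBelow (m + 2) (residual C m) 1) {w : List (Fin 2)} (hw : w.length = m + 2) :
    coeff w (residual C (m + 1)) = coeff w (residual C m) - 2 * coeff w (C (m + 2)) := by
  have he := (exp_agreeBelow_one hC.neg).mono hw.le
  have hR := hR.mono hw.le
  rw [residual, coeff_mul_of_agreeBelow_one (by omega) (he.one_mul_one hR) he,
    coeff_mul_of_agreeBelow_one (by omega) he hR, coeff_exp_of_length (by omega) hC.neg hw,
    coeff_neg]
  ring

/-- Partial products of the increasing product `e^{C 2} e^{C 3} ⋯`. -/
abbrev incProd (C : ℕ → Series K) (N : ℕ) : Series K :=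
  ((List.range N).map fun i => exp (C (i + 2))).prod

/-- Partial products of the decreasing product `⋯ e^{C 3} e^{C 2}`. -/
abbrev decProd (C : ℕ → Series K) (N : ℕ) : Series K :=
  ((List.range N).reverse.map fun i => exp (C (i + 2))).prod

theorem incProd_succ (C : ℕ → Series K) (N : ℕ) :
    incProd C (N + 1) = incProd C N * exp (C (N + 2)) := by
  simp [incProd, List.range_succ]

theorem decProd_succ (C : ℕ → Series K) (N : ℕ) :
    decProd C (N + 1) = exp (C (N + 2)) * decProd C N := by
  simp [decProd, List.range_succ]

theorem incProd_agreeBelow {C : ℕ → Series K} (hC : ∀ n, 2 ≤ n → IsHomogeneous (C n) n) (N : ℕ) :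
    AgreeBelow (N + 2) (incProd C (N + 1)) (incProd C N) := by
  simpa [incProd_succ] using
    (AgreeBelow.refl (N + 2) (incProd C N)).mul (exp_agreeBelow_one (hC (N + 2) (by omega)))

theorem decProd_agreeBelow {C : ℕ → Series K} (hC : ∀ n, 2 ≤ n → IsHomogeneous (C n) n) (N : ℕ) :
    AgreeBelow (N + 2) (decProd C (N + 1)) (decProd C N) := by
  simpa [decProd_succ] using
    (exp_agreeBelow_one (hC (N + 2) (by omega))).mul (AgreeBelow.refl (N + 2) (decProd C N))

theorem incProd_two_mul {C : ℕ → Series K} (hC : ∀ k, 1 ≤ k → C (2 * k) = 0) (N : ℕ) :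
    ((List.range N).map fun i => exp (C (2 * i + 3))).prod = incProd C (2 * N) := by
  induction N with
  | zero => rfl
  | succ N ih =>
    have h0 : C (2 * N + 2) = 0 := hC (N + 1) (by omega)
    rw [Nat.mul_succ, incProd_succ, incProd_succ, h0, exp_zero, mul_one, ← ih]
    simp [List.range_succ]

theorem decProd_two_mul {C : ℕ → Series K} (hC : ∀ k, 1 ≤ k → C (2 * k) = 0) (N : ℕ) :
    ((List.range N).reverse.map fun i => exp (C (2 * i + 3))).prod = decProd C (2 * N) := by
  induction N with
  | zero => rfl
  | succ N ih =>
    have h0 : C (2 * N + 2) = 0 := hC (N + 1) (by omega)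
    rw [Nat.mul_succ, decProd_succ, decProd_succ, h0, exp_zero, one_mul, ← ih]
    simp [List.range_succ]

theorem FactorsExp.odd {C : ℕ → Series K} (h : FactorsExp fun i => exp (C (i + 2)))
    (hC : ∀ k, 1 ≤ k → C (2 * k) = 0) : FactorsExp fun i => exp (C (2 * i + 3)) := by
  obtain ⟨Z, ⟨P, Q, hP, hQ, hZ⟩, h⟩ := h
  have ht : Filter.Tendsto (fun N : ℕ => 2 * N) Filter.atTop Filter.atTop :=
    Filter.tendsto_id.const_mul_atTop' two_pos
  refine ⟨Z, ⟨P, Q, fun w => ?_, fun w => ?_, hZ⟩, h⟩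
  · simp only [incProd_two_mul hC]
    exact ht.eventually (hP w)
  · simp only [decProd_two_mul hC]
    exact ht.eventually (hQ w)

variable [CharZero K]

theorem incProd_mul_residual_mul_decProd {C : ℕ → Series K}
    (hC : ∀ n, 2 ≤ n → IsHomogeneous (C n) n) (N : ℕ) :
    incProd C N * residual C N * decProd C N = residual C 0 := by
  induction N with
  | zero => simp [incProd, decProd]
  | succ N ih =>
    rw [incProd_succ, decProd_succ, ← ih, residual]
    have h1 := exp_mul_exp_neg (by omega) (hC (N + 2) (by omega))
    have h2 := exp_neg_mul_exp (by omega) (hC (N + 2) (by omega))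
    calc _ = incProd C N * (exp (C (N + 2)) * exp (-C (N + 2))) * residual C N *
          (exp (-C (N + 2)) * exp (C (N + 2))) * decProd C N := by simp only [mul_assoc]
      _ = _ := by rw [h1, h2, mul_one, mul_one]

theorem isUnit_exp {f : Series K} {n : ℕ} (hn : 1 ≤ n) (hf : IsHomogeneous f n) :
    IsUnit (exp f) :=
  ⟨⟨exp f, exp (-f), exp_mul_exp_neg hn hf, exp_neg_mul_exp hn hf⟩, rfl⟩

theorem isUnit_incProd {C : ℕ → Series K} (hC : ∀ n, 2 ≤ n → IsHomogeneous (C n) n) (N : ℕ) :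
    IsUnit (incProd C N) := by
  induction N with
  | zero => simp [incProd]
  | succ N ih =>
    rw [incProd_succ]
    exact ih.mul (isUnit_exp (by omega) (hC (N + 2) (by omega)))

theorem isUnit_decProd {C : ℕ → Series K} (hC : ∀ n, 2 ≤ n → IsHomogeneous (C n) n) (N : ℕ) :
    IsUnit (decProd C N) := by
  induction N with
  | zero => simp [decProd]
  | succ N ih =>
    rw [decProd_succ]
    exact (isUnit_exp (by omega) (hC (N + 2) (by omega))).mul ih

/-- Dividing the outer factors `e^{X/2}` and `e^{Y/2}` out of a factorization of `e^{X+Y}` leaves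
`residual C 0`, which does not depend on `C`. -/
theorem exp_factors_iff (C : ℕ → Series K) (Z : Series K) :
    exp (X K + Y K) = exp ((1 / 2 : K) • X K) * exp ((1 / 2 : K) • Y K) * Z *
      exp ((1 / 2 : K) • Y K) * exp ((1 / 2 : K) • X K) ↔ Z = residual C 0 := by
  have hx := exp_mul_exp_neg le_rfl (isHomogeneous_half_X (K := K))
  have hx' := exp_neg_mul_exp le_rfl (isHomogeneous_half_X (K := K))
  have hy := exp_mul_exp_neg le_rfl (isHomogeneous_half_Y (K := K))
  have hy' := exp_neg_mul_exp le_rfl (isHomogeneous_half_Y (K := K))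
  rw [residual]
  generalize exp ((1 / 2 : K) • X K) = x at *
  generalize exp (-((1 / 2 : K) • X K)) = x' at *
  generalize exp ((1 / 2 : K) • Y K) = y at *
  generalize exp (-((1 / 2 : K) • Y K)) = y' at *
  constructor
  · intro h
    rw [h]
    calc Z = y' * ((x' * x) * y * Z * y * (x * x')) * y' := by
          rw [hx, hx', one_mul, mul_one]
          calc Z = (y' * y) * Z * (y * y') := by rw [hy, hy', one_mul, mul_one]
            _ = _ := by simp only [mul_assoc]
      _ = _ := by simp only [mul_assoc]
  · rintro rfl
    calc exp (X K + Y K) = x * ((y * y') * x' * exp (X K + Y K) * x' * (y' * y)) * x := by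
          rw [hy, hy', one_mul, mul_one]
          calc exp (X K + Y K) = (x * x') * exp (X K + Y K) * (x' * x) := by
                rw [hx, hx', one_mul, mul_one]
            _ = _ := by simp only [mul_assoc]
      _ = _ := by simp only [mul_assoc]

/-- The infinite products of homogeneous exponents exist, and they factor `residual C 0` when the
residual factors tend to `1`. -/
theorem exists_prods {C : ℕ → Series K} (hC : ∀ n, 2 ≤ n → IsHomogeneous (C n) n)
    (hR : ∀ m, AgreeBelow (m + 2) (residual C m) 1) :
    ∃ P Q, ConvergesTo (incProd C) P ∧ ConvergesTo (decProd C) Q ∧ P * Q = residual C 0 := by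
  obtain ⟨P, hP⟩ := exists_convergesTo (incProd_agreeBelow hC)
  obtain ⟨Q, hQ⟩ := exists_convergesTo (decProd_agreeBelow hC)
  refine ⟨P, Q, hP, hQ, ?_⟩
  ext w
  have h1 := agreeBelow_of_convergesTo (incProd_agreeBelow hC) hP w.length
  have h2 := agreeBelow_of_convergesTo (decProd_agreeBelow hC) hQ w.length
  have h3 := ((AgreeBelow.refl _ (incProd C w.length)).mul (hR w.length)).mul
    (.refl _ (decProd C w.length))
  rw [incProd_mul_residual_mul_decProd hC, mul_one] at h3
  exact ((h1.mul h2).trans h3.symm) w (by omega)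

theorem IsDecomposition.residual_agreeBelow_one {C : ℕ → Series K} (hC : IsDecomposition C)
    (m : ℕ) : AgreeBelow (m + 2) (residual C m) 1 := by
  obtain ⟨Z, ⟨P, Q, hP, hQ, rfl⟩, hZ⟩ := hC.factors
  rw [exp_factors_iff C] at hZ
  have h1 := agreeBelow_of_convergesTo (incProd_agreeBelow hC.homogeneous) hP m
  have h2 := agreeBelow_of_convergesTo (decProd_agreeBelow hC.homogeneous) hQ m
  have h3 := h1.mul h2
  rw [hZ, ← incProd_mul_residual_mul_decProd hC.homogeneous m] at h3
  obtain ⟨u, hu⟩ := (isUnit_incProd hC.homogeneous m).exists_left_inv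
  obtain ⟨v, hv⟩ := (isUnit_decProd hC.homogeneous m).exists_right_inv
  have h4 := ((AgreeBelow.refl _ u).mul h3).mul (.refl _ v)
  have e1 : u * (incProd C m * residual C m * decProd C m) * v = residual C m := by
    calc _ = (u * incProd C m) * residual C m * (decProd C m * v) := by simp only [mul_assoc]
      _ = _ := by rw [hu, hv, one_mul, mul_one]
  have e2 : u * (incProd C m * decProd C m) * v = 1 := by
    calc _ = (u * incProd C m) * (decProd C m * v) := by simp only [mul_assoc]
      _ = _ := by rw [hu, hv, one_mul]
  rwa [e1, e2] at h4

/-- In a decomposition, `2 C_n` is the component of degree `n` of the residual factor that precedes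
it. -/
theorem IsDecomposition.two_mul_coeff {C : ℕ → Series K} (hC : IsDecomposition C) {m : ℕ}
    {w : List (Fin 2)} (hw : w.length = m + 2) :
    2 * coeff w (C (m + 2)) = coeff w (residual C m) := by
  have h := coeff_residual_succ (hC.homogeneous (m + 2) (by omega))
    (hC.residual_agreeBelow_one m) hw
  rw [hC.residual_agreeBelow_one (m + 1) w (by omega), coeff_one, if_neg (by omega)] at h
  exact (sub_eq_zero.1 h.symm).symm

theorem IsDecomposition.unique {C C' : ℕ → Series K} (hC : IsDecomposition C)
    (hC' : IsDecomposition C') (n : ℕ) (hn : 2 ≤ n) : C' n = C n := by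
  induction n using Nat.strong_induction_on with
  | _ n ih =>
    obtain ⟨m, rfl⟩ := Nat.exists_eq_add_of_le' hn
    ext w
    by_cases hw : w.length = m + 2
    · have h1 := hC.two_mul_coeff hw
      rw [← residual_congr fun k hk hkm => ih k hkm hk, ← hC'.two_mul_coeff hw] at h1
      exact (mul_left_cancel₀ two_ne_zero h1).symm
    · rw [hC.homogeneous _ hn w hw, hC'.homogeneous _ hn w hw]

/-! ### The exponents generated by the recursion -/

/-- The effect on the equation `E P = F P - P G` of dividing `P` by `e^c` on both sides. -/
theorem euler_exp_neg_mul_mul_exp_neg {P : Series K} {f g : ℕ → Series K} (hf : IsGraded f)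
    (hg : IsGraded g) (hP : euler P = gather f * P - P * gather g) {c : Series K} {n : ℕ}
    (hn : 1 ≤ n) (hc : IsHomogeneous c n) :
    euler (exp (-c) * P * exp (-c)) = gather (step (-1) n c f) * (exp (-c) * P * exp (-c)) -
      (exp (-c) * P * exp (-c)) * gather (step 1 n c g) := by
  have hc1 : ∀ s : K, IsHomogeneous ((s * (n : K)) • c) (n - 1 + 1) := by
    intro s
    rw [Nat.sub_add_cancel hn]
    exact hc.smul _
  have hcor : ∀ (s : K) (h : ℕ → Series K),
      (fun l => if l = n - 1 then h l + (s * (n : K)) • c else h l) =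
        h + fun l => if l = n - 1 then (s * (n : K)) • c else 0 := by
    intro s h
    funext l
    rw [Pi.add_apply]
    split_ifs with hl
    · rfl
    · rw [add_zero]
  have hgr : ∀ (s : K) {h : ℕ → Series K}, IsGraded h →
      IsGraded (h + fun l => if l = n - 1 then (s * (n : K)) • c else 0) :=
    fun s h hh l => (hh l).add (isGraded_single (hc1 s) l)
  have key : ∀ (s : K) {h : ℕ → Series K}, IsGraded h →
      gather (step s n c h) =
        exp (s • c) * (gather h + (s * (n : K)) • c) * exp (-(s • c)) := by
    intro s h hh
    rw [step, hcor, ← exp_mul_gather_mul_exp_neg hn hc (hgr s hh), gather_add,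
      gather_single (hc1 s)]
  rw [key _ hf, key _ hg, neg_one_smul, one_smul, neg_neg, neg_one_mul, one_mul, neg_smul,
    euler_mul, euler_mul, hP, euler_exp hn hc.neg, smul_neg]
  have h1 := exp_mul_exp_neg hn hc
  have h2 := exp_neg_mul_exp hn hc
  have h3 : ((n : K) • c) * exp (-c) = exp (-c) * ((n : K) • c) := by
    have := (commute_exp (hc.neg.coeff_nil hn)).eq
    rw [neg_mul, mul_neg, neg_inj] at this
    rw [smul_mul_assoc, mul_smul_comm, this]
  generalize (n : K) • c = a at *
  generalize exp c = v at *
  generalize exp (-c) = u at *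
  generalize gather f = F at *
  generalize gather g = G at *
  calc _ = -(a * u) * P * u + u * (F * P - P * G) * u + u * P * (-a * u) := by noncomm_ring
    _ = u * (F + -a) * P * u - u * P * (G + a) * u := by rw [h3]; noncomm_ring
    _ = u * (F + -a) * (v * u) * P * u - u * P * (u * v) * (G + a) * u := by
        rw [h1, h2, mul_one, mul_one]
    _ = _ := by noncomm_ring

end Residual

end SymmetricZassenhaus

namespace SymmetricZassenhaus

open NCSeries

attribute [local instance] LieRing.ofAssociativeRing

section Term

variable {K : Type*} [Field K] [CharZero K]

theorem isHomogeneous_term (n : ℕ) (hn : 2 ≤ n) : IsHomogeneous (term K n) n := by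
  obtain ⟨m, rfl⟩ := Nat.exists_eq_add_of_le' hn
  exact (isLieGraded_families m).2.2.2

theorem term_mem (n : ℕ) (hn : 2 ≤ n) : term K n ∈ liePolynomials K := by
  obtain ⟨m, rfl⟩ := Nat.exists_eq_add_of_le' hn
  exact (isLieGraded_families m).2.2.1

theorem euler_residual_term (m : ℕ) :
    euler (residual (term K) m) = gather (families K m).1 * residual (term K) m -
      residual (term K) m * gather (families K m).2 := by
  induction m with
  | zero =>
    have hX := smul_mem_liePolynomials (1 / 2 : K) (X_mem (K := K))
    have hXY := (isHomogeneous_X (K := K)).add isHomogeneous_Y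
    have hf : IsLieGraded fun l => if l = 0 then X K + Y K else 0 := by
      intro l
      dsimp only
      split_ifs with hl
      · exact ⟨(liePolynomials K).add_mem X_mem Y_mem, hl ▸ hXY⟩
      · exact ⟨(liePolynomials K).zero_mem, .zero _⟩
    have hg : IsLieGraded fun _ => (0 : Series K) :=
      fun l => ⟨(liePolynomials K).zero_mem, .zero _⟩
    have hE : euler (exp (X K + Y K)) =
        gather (fun l => if l = 0 then X K + Y K else 0) * exp (X K + Y K) -
          exp (X K + Y K) * gather fun _ => (0 : Series K) := by
      have h0 : gather (fun _ => (0 : Series K)) = 0 := rfl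
      rw [euler_exp le_rfl hXY, gather_single hXY, h0, mul_zero, sub_zero, Nat.cast_one, one_smul]
    have h1 := euler_exp_neg_mul_mul_exp_neg hf.isGraded hg.isGraded hE le_rfl isHomogeneous_half_X
    have h2 := euler_exp_neg_mul_mul_exp_neg
      (isLieGraded_step le_rfl hX isHomogeneous_half_X hf _).isGraded
      (isLieGraded_step le_rfl hX isHomogeneous_half_X hg _).isGraded h1 le_rfl
      isHomogeneous_half_Y
    rw [← fInit_eq_step, ← gInit_eq_step] at h2
    exact h2
  | succ m ih =>
    obtain ⟨hf, hg, -, hc⟩ := isLieGraded_families (K := K) m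
    exact euler_exp_neg_mul_mul_exp_neg hf.isGraded hg.isGraded ih (by omega) hc

/-- The Euler equation of the residual factor gives its lowest component in terms of the families
of the recursion. -/
theorem coeff_residual_term {m : ℕ} (hR : AgreeBelow (m + 2) (residual (term K) m) 1)
    {w : List (Fin 2)} (hw : w.length = m + 2) :
    coeff w (residual (term K) m) = 2 * coeff w (term K (m + 2)) := by
  obtain ⟨hf, hg, -, -⟩ := isLieGraded_families (K := K) m
  have h := coeff_of_euler_eq (euler_residual_term m) ((hf 0).2.coeff_nil le_rfl)
    ((hg 0).2.coeff_nil le_rfl) (hR.mono hw.le)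
  have hm : ((m + 2 : ℕ) : K) ≠ 0 := by exact_mod_cast Nat.succ_ne_zero (m + 1)
  rw [hw, coeff_gather, coeff_gather, hw] at h
  have ht : coeff w (term K (m + 2)) = (1 / (2 * ((m + 2 : ℕ) : K))) *
      (coeff w ((families K m).1 (m + 2 - 1)) - coeff w ((families K m).2 (m + 2 - 1))) := by
    rw [← coeff_sub]
    rfl
  rw [ht, ← h]
  field_simp

theorem residual_term_agreeBelow_one (m : ℕ) :
    AgreeBelow (m + 2) (residual (term K) m) 1 := by
  induction m with
  | zero =>
    have h0 : coeff [] (residual (term K) 0) = 1 := by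
      simp only [residual, coeff_mul_nil, coeff_nil_exp, mul_one]
    have h1 : AgreeBelow 1 (residual (term K) 0) 1 := by
      intro w hw
      rw [List.length_eq_zero_iff.1 (Nat.lt_one_iff.1 hw), h0, coeff_nil_one]
    intro w hw
    by_cases hw1 : w.length = 1
    · obtain ⟨hf, hg, -, -⟩ := isLieGraded_families (K := K) 0
      have h := coeff_of_euler_eq (euler_residual_term 0) ((hf 0).2.coeff_nil le_rfl)
        ((hg 0).2.coeff_nil le_rfl) (h1.mono hw1.le)
      -- `f_{1,0} = g_{1,0}`
      rw [coeff_gather, coeff_gather, hw1, Nat.cast_one, one_mul,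
        show (families K 0).1 (1 - 1) = (families K 0).2 (1 - 1) from rfl, sub_self] at h
      rw [h, coeff_one, if_neg (by omega)]
    · exact h1 w (by omega)
  | succ m ih =>
    intro w hw
    have hc := isHomogeneous_term (K := K) (m + 2) (by omega)
    by_cases hwm : w.length = m + 2
    · rw [coeff_residual_succ hc ih hwm, coeff_residual_term ih hwm, sub_self, coeff_one,
        if_neg (by omega)]
    · have he := exp_agreeBelow_one hc.neg
      exact (he.one_mul_one ih).one_mul_one he w (by omega)

theorem isDecomposition_term : IsDecomposition (term K) where
  lie := term_mem
  homogeneous := isHomogeneous_term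
  factors := by
    obtain ⟨P, Q, hP, hQ, hPQ⟩ :=
      exists_prods isHomogeneous_term (residual_term_agreeBelow_one (K := K))
    exact ⟨P * Q, ⟨P, Q, hP, hQ, rfl⟩, (exp_factors_iff _ _).2 hPQ⟩

/-! ### Vanishing of the exponents of even degree -/

/-- If a residual factor is inverted by `X ↦ -X`, `Y ↦ -Y`, then its lowest component, a
multiple of the next exponent, has odd degree. -/
theorem term_eq_zero_of_signHom_mul {m : ℕ}
    (h : signHom (residual (term K) m) * residual (term K) m = 1) (hm : Even m) :
    term K (m + 2) = 0 := by
  ext w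
  by_cases hw : w.length = m + 2
  · have hR := (residual_term_agreeBelow_one (K := K) m).mono hw.le
    have h1 := congrArg (coeff w) h
    have hsign : (-1 : K) ^ w.length = 1 := by
      rw [hw]; exact (hm.add even_two).neg_one_pow
    rw [coeff_mul_of_agreeBelow_one (by omega) hR.signHom_one hR, coeff_signHom, hsign, one_mul,
      coeff_one, if_neg (by omega), ← two_mul,
      coeff_residual_term (residual_term_agreeBelow_one m) hw] at h1
    simpa using h1
  · rw [isHomogeneous_term _ (by omega) w hw, coeff_zero]

/-- The symmetry of the factorization: `X ↦ -X`, `Y ↦ -Y` inverts all the residual factors. -/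
theorem signHom_residual_term_mul (m : ℕ) :
    signHom (residual (term K) m) * residual (term K) m = 1 := by
  have hneg : ∀ {f : Series K} {n : ℕ}, IsHomogeneous f n → Odd n → signHom f = -f := by
    intro f n hf hn
    rw [hf.signHom_eq, hn.neg_one_pow, neg_one_smul]
  induction m with
  | zero =>
    have hXY := (isHomogeneous_X (K := K)).add isHomogeneous_Y
    have hx := exp_mul_exp_neg le_rfl (isHomogeneous_half_X (K := K))
    have hy := exp_mul_exp_neg le_rfl (isHomogeneous_half_Y (K := K))
    have hs := exp_neg_mul_exp le_rfl hXY
    simp only [residual, map_mul, signHom_exp, map_neg, hneg isHomogeneous_half_X odd_one,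
      hneg isHomogeneous_half_Y odd_one, hneg hXY odd_one, neg_neg]
    generalize exp ((1 / 2 : K) • X K) = x at *
    generalize exp (-((1 / 2 : K) • X K)) = x' at *
    generalize exp ((1 / 2 : K) • Y K) = y at *
    generalize exp (-((1 / 2 : K) • Y K)) = y' at *
    generalize exp (X K + Y K) = s at *
    generalize exp (-(X K + Y K)) = s' at *
    calc _ = y * (x * (s' * (x * (y * y') * x') * s) * x') * y' := by simp only [mul_assoc]
      _ = 1 := by rw [hy, mul_one, hx, mul_one, hs, mul_one, hx, mul_one, hy]
  | succ m ih =>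
    rcases Nat.even_or_odd m with hm | hm
    · rw [residual, term_eq_zero_of_signHom_mul ih hm, neg_zero, exp_zero, one_mul, mul_one, ih]
    · have hc := isHomogeneous_term (K := K) (m + 2) (by omega)
      have h1 := exp_mul_exp_neg (by omega) hc
      rw [residual, map_mul, map_mul, signHom_exp, map_neg, hneg hc (hm.add_even even_two), neg_neg]
      calc _ = exp (term K (m + 2)) * (signHom (residual (term K) m) *
            (exp (term K (m + 2)) * exp (-term K (m + 2))) * residual (term K) m) *
            exp (-term K (m + 2)) := by simp only [mul_assoc]
        _ = 1 := by rw [h1, mul_one, ih, mul_one, h1]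

theorem term_even (k : ℕ) (hk : 1 ≤ k) : term K (2 * k) = 0 := by
  obtain ⟨j, rfl⟩ := Nat.exists_eq_add_of_le' hk
  exact term_eq_zero_of_signHom_mul (signHom_residual_term_mul _) (even_two_mul j)

/-! ### The recursion restricted to odd degrees -/

theorem families_even_step (m : ℕ) : families K (2 * m + 1) = families K (2 * m) := by
  have h0 : nextTerm (2 * m + 2) (families K (2 * m)) = 0 := term_even (m + 1) (by omega)
  rw [families, h0, step_zero_left, step_zero_left]

theorem oddFamilies_eq (m : ℕ) : oddFamilies K m = families K (2 * m) := by
  induction m with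
  | zero => rfl
  | succ m ih =>
    rw [oddFamilies, ih, oddStep_eq_step _ (by omega), oddStep_eq_step _ (by omega),
      ← families_even_step]
    rfl

theorem term_eq_oddTerm (m : ℕ) : term K (2 * m + 3) = oddTerm K m := by
  rw [oddTerm, oddFamilies_eq, ← families_even_step]
  rfl

end Term

end SymmetricZassenhaus

theorem theorem1 (K : Type*) [Field K] [CharZero K] :
    ∃ C : ℕ → SymmetricZassenhaus.Series K,
      -- existence of the factorization
      SymmetricZassenhaus.IsDecomposition C ∧
      -- uniqueness of the exponents
      (∀ C' : ℕ → SymmetricZassenhaus.Series K, SymmetricZassenhaus.IsDecomposition C' →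
        ∀ n, 2 ≤ n → C' n = C n) ∧
      -- the exponents of even degree vanish
      (∀ k, 1 ≤ k → C (2 * k) = 0) ∧
      -- the factorization with only the exponents of degrees 3, 5, 7, …
      SymmetricZassenhaus.FactorsExp (fun i => NCSeries.exp (C (2 * i + 3))) ∧
      -- the exponents are generated by the recursion over all degrees
      (∀ k, 2 ≤ k → C k = SymmetricZassenhaus.term K k) ∧
      -- and by the recursion restricted to odd degrees
      (∀ m, C (2 * m + 3) = SymmetricZassenhaus.oddTerm K m) :=
  ⟨SymmetricZassenhaus.term K, SymmetricZassenhaus.isDecomposition_term,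
    fun _ hC' => SymmetricZassenhaus.isDecomposition_term.unique hC',
    SymmetricZassenhaus.term_even,
    SymmetricZassenhaus.isDecomposition_term.factors.odd SymmetricZassenhaus.term_even,
    fun _ _ => rfl, SymmetricZassenhaus.term_eq_oddTerm⟩
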